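/- For a family $\mathcal I$ of subsets of a set $X$, let $\mathrm{cov}(\mathcal I)=\min\{|\mathcal A| : \mathcal A\subseteq\mathcal I,\ \bigcup\mathcal A=X\}$, with $\mathrm{cov}(\mathcal I)=\infty$ (larger than every cardinal) if no such $\mathcal A$ exists. For a measure $\mu$ on $X$, let $\mathrm{cov}(\mu)$ be the covering number of the ideal of all $\mu$-null subsets of $X$ (all subsets of measurable sets of measure zero). Let $\mathcal N_{\omega_1}$ be the ideal of null subsets of $2^{\omega_1}$ with respect to the standard product measure $\lambda_{\omega_1}$ (the product of $\omega_1$ copies of the uniform probability measure on $\{0,1\}$). If $\mathrm{cov}(\mathcal N_{\omega_1})>\omega_1$, then $\mathrm{cov}(\mu)>\omega_1$ for every nonzero finite Radon measure $\mu$ on a compact Hausdorff space $K$, that is, for every nonzero finite Borel measure $\mu$ on $K$ that is inner regular with respect to compact sets. -/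

import Mathlib

open MeasureTheory
open scoped Cardinal

/-- The covering number `cov(I)`: the least cardinality of a subfamily of `I` with union the whole
space. It is `⊤` when no subfamily of `I` covers the space. -/
noncomputable def cov {X : Type*} (I : Set (Set X)) : WithTop Cardinal :=
  ⨅ A ∈ {A : Set (Set X) | A ⊆ I ∧ ⋃₀ A = Set.univ}, ((#A : Cardinal) : WithTop Cardinal)

/-- The ideal of `μ`-null sets. Mathlib evaluates `μ` on an arbitrary set as an outer measure, so
this consists of all subsets of measurable sets of measure zero. -/
def nullIdeal {X : Type*} [MeasurableSpace X] (μ : Measure X) : Set (Set X) :=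
  {N | μ N = 0}

/-- The standard product measure on `2^ι`: the product of the uniform probability measures on the
two-point set. It is given on the product `σ`-algebra, over which the Borel sets of `2^ι` are
measurable up to completion, so its null subsets are those of its Borel extension. -/
noncomputable def cantorMeasure (ι : Type*) : Measure (ι → Bool) :=
  Measure.infinitePi fun _ : ι => (PMF.uniformOfFintype Bool).toMeasure

/-- The ideal `N_κ` of null subsets of `2^κ`, where the cardinal `κ` is represented by a type of
cardinality `κ`. -/
noncomputable def nullIdealCantor (κ : Cardinal) : Set (Set (κ.out → Bool)) :=
  nullIdeal (cantorMeasure κ.out)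

/-!
Every probability measure on a product of `#T` standard Borel spaces is an image of the coin-tossing
measure on `2^T`: well-order the index set, split the coins into `#T` independent uniform variables,
and use the `i`-th of them to sample the `i`-th coordinate from its conditional law given the
earlier ones. Given null sets `N t` of a Radon probability measure, fill the complement of `N t` up
to measure zero by compact sets `F t n`, and apply this to the law of the membership pattern
`(t, n) ↦ (k ∈ F t n)` of a random point `k`. If `2^T` is not covered by `#T` null sets, there is a
pattern that contains some `(t, n t)` for each `t` and of which every finite part has positive
probability. The compact sets `F t (n t)` then have the finite intersection property, and a common
point of them lies in no `N t`.
-/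

open ProbabilityTheory Filter Topology Set

universe u v w

theorem continuous_cdf (m : Measure ℝ) [IsProbabilityMeasure m] [NullSingletonClass m] :
    Continuous (cdf m) := by
  refine continuous_iff_continuousAt.2 fun a => ?_
  rw [(monotone_cdf m).continuousAt_iff_leftLim_eq_rightLim, StieltjesFunction.rightLim_eq]
  have no_jump := (cdf m).measure_singleton a
  rw [measure_cdf, measure_singleton, eq_comm, ENNReal.ofReal_eq_zero, sub_nonpos] at no_jump
  exact le_antisymm ((monotone_cdf m).leftLim_le le_rfl) no_jump

theorem exists_cdf_eq (m : Measure ℝ) [IsProbabilityMeasure m] [NullSingletonClass m] {p : ℝ}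
    (hp : p ∈ Ioo (0 : ℝ) 1) : ∃ t, cdf m t = p := by
  obtain ⟨a, ha⟩ := ((tendsto_cdf_atBot m).eventually (gt_mem_nhds hp.1)).exists
  obtain ⟨b, hb⟩ := ((tendsto_cdf_atTop m).eventually (lt_mem_nhds hp.2)).exists
  exact mem_range_of_exists_le_of_exists_ge (continuous_cdf m) ⟨a, ha.le⟩ ⟨b, hb.le⟩

theorem measure_setOf_cdf_lt_le (m : Measure ℝ) [IsProbabilityMeasure m] [NullSingletonClass m]
    {q : ℝ} (hq : 0 < q) : m {x | cdf m x < q} ≤ ENNReal.ofReal q := by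
  rcases le_or_gt 1 q with hq1 | hq1
  · exact prob_le_one.trans (by simpa using hq1)
  · obtain ⟨t, rfl⟩ := exists_cdf_eq m ⟨hq, hq1⟩
    rw [ofReal_cdf]
    exact measure_mono fun x hx => ((monotone_cdf m).reflect_lt hx).le

theorem le_measure_setOf_cdf_le (m : Measure ℝ) [IsProbabilityMeasure m] [NullSingletonClass m]
    {p : ℝ} (hp : p ≤ 1) : ENNReal.ofReal p ≤ m {x | cdf m x ≤ p} := by
  rcases le_or_gt p 0 with hp0 | hp0
  · simp [ENNReal.ofReal_of_nonpos hp0]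
  rcases hp.eq_or_lt with rfl | hp1
  · simp [cdf_le_one]
  obtain ⟨t, rfl⟩ := exists_cdf_eq m ⟨hp0, hp1⟩
  rw [ofReal_cdf]
  exact measure_mono fun x hx => monotone_cdf m hx

theorem measure_setOf_cdf_le (m : Measure ℝ) [IsProbabilityMeasure m] [NullSingletonClass m]
    {p : ℝ} (hp : p ∈ Icc (0 : ℝ) 1) : m {x | cdf m x ≤ p} = ENNReal.ofReal p := by
  refine le_antisymm ?_ (le_measure_setOf_cdf_le m hp.2)
  refine ge_of_tendsto (x := 𝓝[>] p) (f := ENNReal.ofReal)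
    ((ENNReal.continuous_ofReal.tendsto p).mono_left nhdsWithin_le_nhds) ?_
  filter_upwards [self_mem_nhdsWithin] with q (hq : p < q)
  exact (measure_mono fun x (hx : cdf m x ≤ p) => hx.trans_lt hq).trans
    (measure_setOf_cdf_lt_le m (hp.1.trans_lt hq))

theorem measurePreserving_cdf (m : Measure ℝ) [IsProbabilityMeasure m] [NullSingletonClass m] :
    MeasurePreserving (fun x => (⟨cdf m x, cdf_nonneg m x, cdf_le_one m x⟩ : unitInterval))
      m volume := by
  have measurable : Measurable
      fun x => (⟨cdf m x, cdf_nonneg m x, cdf_le_one m x⟩ : unitInterval) :=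
    (monotone_cdf m).measurable.subtype_mk
  refine ⟨measurable, ?_⟩
  have := Measure.isProbabilityMeasure_map (μ := m) measurable.aemeasurable
  refine Measure.ext_of_Iic _ _ fun p => ?_
  rw [Measure.map_apply measurable measurableSet_Iic, unitInterval.volume_Iic]
  exact measure_setOf_cdf_le m p.2

theorem exists_measurePreserving_unitInterval {Y : Type*} [MeasurableSpace Y]
    [StandardBorelSpace Y] (m : Measure Y) [IsProbabilityMeasure m] [NullSingletonClass m] :
    ∃ u : Y → unitInterval, MeasurePreserving u m volume := by
  have embedding := measurableEmbedding_embeddingReal Y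
  have := Measure.isProbabilityMeasure_map (μ := m) embedding.measurable.aemeasurable
  have : NullSingletonClass (m.map (embeddingReal Y)) := ⟨fun x => by
    rw [embedding.map_apply]
    exact (subsingleton_singleton.preimage embedding.injective).measure_zero m⟩
  exact ⟨_, (measurePreserving_cdf _).comp (embedding.measurable.measurePreserving m)⟩

instance isProbabilityMeasure_cantorMeasure (ι : Type*) :
    IsProbabilityMeasure (cantorMeasure ι) := by
  unfold cantorMeasure
  infer_instance

theorem cantorMeasure_cylinder {ι : Type*} (s : Finset ι) (x : ι → Bool) :
    cantorMeasure ι ((s : Set ι).pi fun i => {x i}) = 2⁻¹ ^ s.card := by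
  rw [cantorMeasure, Measure.infinitePi_pi _ fun i _ => measurableSet_singleton (x i)]
  simp

instance nullSingletonClass_cantorMeasure (ι : Type*) [Infinite ι] :
    NullSingletonClass (cantorMeasure ι) := by
  refine ⟨fun x => le_antisymm (ge_of_tendsto' (ENNReal.tendsto_pow_atTop_nhds_zero_of_lt_one
    (r := 2⁻¹) (by simp)) fun n => ?_) bot_le⟩
  obtain ⟨s, rfl⟩ := Infinite.exists_subset_card_eq ι n
  rw [← cantorMeasure_cylinder s x]
  exact measure_mono (by rintro _ rfl; simp)

theorem measurePreserving_curry_cantorMeasure {T I J : Type*} (e : I × J ↪ T) :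
    MeasurePreserving (fun (x : T → Bool) i j => x (e (i, j))) (cantorMeasure T)
      (Measure.infinitePi fun _ : I => cantorMeasure J) := by
  let b : Measure Bool := (PMF.uniformOfFintype Bool).toMeasure
  have reindex : MeasurePreserving (fun (x : T → Bool) (p : I × J) => x (e p))
      (cantorMeasure T) (cantorMeasure (I × J)) :=
    ⟨by fun_prop, Measure.map_infinitePi_infinitePi_of_inj (P := fun _ => b) e.injective⟩
  have curry : MeasurePreserving (MeasurableEquiv.curry I J Bool) (cantorMeasure (I × J))
      (Measure.infinitePi fun _ : I => cantorMeasure J) :=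
    ⟨by fun_prop, Measure.infinitePi_map_curry fun _ _ => b⟩
  exact curry.comp reindex

theorem exists_measurePreserving_cantorMeasure_infinitePi {T I : Type*} (e : I × ℕ ↪ T) :
    ∃ U : (T → Bool) → I → unitInterval,
      MeasurePreserving U (cantorMeasure T) (Measure.infinitePi fun _ : I => volume) := by
  obtain ⟨u, hu⟩ := exists_measurePreserving_unitInterval (cantorMeasure ℕ)
  have coordinatewise : MeasurePreserving (fun (x : I → ℕ → Bool) i => u (x i))
      (Measure.infinitePi fun _ => cantorMeasure ℕ) (Measure.infinitePi fun _ => volume) :=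
    ⟨measurable_pi_lambda _ fun i => hu.measurable.comp (measurable_pi_apply i), by
      simpa only [hu.map_eq] using
        Measure.infinitePi_map_pi (fun _ : I => cantorMeasure ℕ) fun _ => hu.measurable⟩
  exact ⟨_, coordinatewise.comp (measurePreserving_curry_cantorMeasure e)⟩

section WellOrderedProduct

variable {I : Type*} {Y : I → Type*} [∀ i, MeasurableSpace (Y i)]

theorem measure_pi_ext_of_map_domRestrict_Iic [Preorder I] [IsDirectedOrder I]
    {ν ν' : Measure (∀ i, Y i)} [IsProbabilityMeasure ν] [IsProbabilityMeasure ν']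
    (h : ∀ i, ν.map (Iic i).domRestrict = ν'.map (Iic i).domRestrict) : ν = ν' := by
  rcases isEmpty_or_nonempty I with _ | _
  · exact Measure.ext fun s _ => Subsingleton.set_cases (by simp) (by simp) s
  refine IsProjectiveLimit.unique (P := fun J => ν'.map J.restrict) (fun J => ?_) fun _ => rfl
  obtain ⟨i, hi⟩ := J.exists_le
  have restrict_J : J.restrict = (fun (z : ∀ j : Iic i, Y j) (j : J) => z ⟨j, hi j j.2⟩) ∘
      (Iic i).domRestrict := rfl
  change ν.map J.restrict = ν'.map J.restrict
  rw [restrict_J, ← Measure.map_map (by fun_prop) (by fun_prop), h,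
    Measure.map_map (by fun_prop) (by fun_prop)]

variable [LinearOrder I]

theorem map_domRestrict_Iio_eq {ν ν' : Measure (∀ i, Y i)} [IsProbabilityMeasure ν]
    [IsProbabilityMeasure ν'] {i : I}
    (h : ∀ j < i, ν.map (Iic j).domRestrict = ν'.map (Iic j).domRestrict) :
    ν.map (Iio i).domRestrict = ν'.map (Iio i).domRestrict := by
  have := Measure.isProbabilityMeasure_map (μ := ν) (f := (Iio i).domRestrict) (by fun_prop)
  have := Measure.isProbabilityMeasure_map (μ := ν') (f := (Iio i).domRestrict) (by fun_prop)
  refine measure_pi_ext_of_map_domRestrict_Iic fun j => ?_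
  have restrict_Iic : (Iic j).domRestrict ∘ (Iio i).domRestrict (π := Y) =
      (fun z (k : Iic j) => z ⟨k, k.2⟩) ∘ (Iic j.1).domRestrict := rfl
  rw [Measure.map_map (by fun_prop) (by fun_prop), Measure.map_map (by fun_prop) (by fun_prop),
    restrict_Iic, ← Measure.map_map (by fun_prop) (by fun_prop), h j j.2,
    Measure.map_map (by fun_prop) (by fun_prop)]

theorem map_domRestrict_Iic_eq {ν ν' : Measure (∀ i, Y i)} {i : I}
    (h : ν.map (fun y => ((Iio i).domRestrict y, y i)) =
      ν'.map fun y => ((Iio i).domRestrict y, y i)) :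
    ν.map (Iic i).domRestrict = ν'.map (Iic i).domRestrict := by
  let glue (z : (∀ j : Iio i, Y j) × Y i) (k : Iic i) : Y k :=
    if hk : k.1 < i then z.1 ⟨k, hk⟩ else (le_antisymm (not_lt.1 hk) k.2) ▸ z.2
  have measurable_glue : Measurable glue := by
    refine measurable_pi_lambda _ fun ⟨k, hk⟩ => ?_
    rcases (mem_Iic.1 hk).lt_or_eq with hk | rfl
    · simp only [glue, hk, dite_true]
      fun_prop
    · simp only [glue, lt_irrefl, dite_false]
      fun_prop
  have glue_comp : (Iic i).domRestrict = glue ∘ fun y => ((Iio i).domRestrict y, y i) := by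
    ext y ⟨k, hk⟩
    rcases (mem_Iic.1 hk).lt_or_eq with hk | rfl
    · simp [glue, hk]
    · simp [glue]
  rw [glue_comp, ← Measure.map_map measurable_glue (by fun_prop), h,
    Measure.map_map measurable_glue (by fun_prop)]

end WellOrderedProduct

section TransfiniteRecursion

variable {I : Type*} [LinearOrder I] [WellFoundedLT I] {Ω Y : I → Type*}

/-- The family `y` determined by the innovations `x` through the transfinite recursion
`y i = φ i (y restricted to the predecessors of i) (x i)`. -/
noncomputable def transfiniteRec (φ : ∀ i, (∀ j : Iio i, Y j) → Ω i → Y i) (x : ∀ i, Ω i) :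
    ∀ i, Y i :=
  WellFoundedLT.fix fun i y => φ i (fun j => y j j.2) (x i)

theorem transfiniteRec_eq (φ : ∀ i, (∀ j : Iio i, Y j) → Ω i → Y i) (x : ∀ i, Ω i) (i : I) :
    transfiniteRec φ x i = φ i ((Iio i).domRestrict (transfiniteRec φ x)) (x i) := by
  rw [transfiniteRec, WellFoundedLT.fix_eq]
  rfl

variable [∀ i, MeasurableSpace (Ω i)] [∀ i, MeasurableSpace (Y i)]
  {φ : ∀ i, (∀ j : Iio i, Y j) → Ω i → Y i}

theorem measurable_transfiniteRec_iSup_comap (hφ : ∀ i, Measurable (φ i).uncurry) (i : I) :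
    Measurable[⨆ j ∈ Iic i, MeasurableSpace.comap (fun x : ∀ i, Ω i => x j) inferInstance]
      fun x => transfiniteRec φ x i := by
  induction i using WellFoundedLT.induction with
  | ind i ih =>
    simp_rw [transfiniteRec_eq φ _ i]
    refine (hφ i).comp (Measurable.prodMk (@measurable_pi_lambda _ _ _ (_) _ _ fun j => ?_) ?_)
    · exact (ih j j.2).mono (biSup_mono fun k hk => le_trans (mem_Iic.1 hk) (le_of_lt j.2)) le_rfl
    · exact (comap_measurable _).mono (le_biSup (fun j => MeasurableSpace.comap
        (fun x : ∀ i, Ω i => x j) inferInstance) (mem_Iic.2 le_rfl)) le_rfl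

theorem measurable_transfiniteRec (hφ : ∀ i, Measurable (φ i).uncurry) :
    Measurable (transfiniteRec φ) :=
  measurable_pi_lambda _ fun i => (measurable_transfiniteRec_iSup_comap hφ i).mono
    (iSup₂_le fun j _ => (measurable_pi_apply j).comap_le) le_rfl

theorem indepFun_domRestrict_Iio_transfiniteRec (hφ : ∀ i, Measurable (φ i).uncurry)
    (P : ∀ i, Measure (Ω i)) [∀ i, IsProbabilityMeasure (P i)] (i : I) :
    IndepFun (fun x => (Iio i).domRestrict (transfiniteRec φ x)) (fun x => x i)
      (Measure.infinitePi P) := by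
  have past_indep_present := indep_iSup_of_disjoint (S := Iio i) (T := {i})
    (fun j => (measurable_pi_apply j).comap_le)
    (iIndepFun_infinitePi (P := P) (X := fun _ x => x) (by fun_prop)) (by simp)
  refine indep_of_indep_of_le_left (indep_of_indep_of_le_right past_indep_present
    (le_iSup₂_of_le i rfl le_rfl)) ?_
  refine Measurable.comap_le (@measurable_pi_lambda _ _ _ (_) _ _ fun j => ?_)
  exact (measurable_transfiniteRec_iSup_comap hφ j).mono
    (biSup_mono fun k hk => lt_of_le_of_lt (mem_Iic.1 hk) j.2) le_rfl

theorem map_transfiniteRec_eq_map_prod (hφ : ∀ i, Measurable (φ i).uncurry)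
    (P : ∀ i, Measure (Ω i)) [∀ i, IsProbabilityMeasure (P i)] (i : I) :
    ((Measure.infinitePi P).map (transfiniteRec φ)).map
        (fun y => ((Iio i).domRestrict y, y i)) =
      ((((Measure.infinitePi P).map (transfiniteRec φ)).map (Iio i).domRestrict).prod (P i)).map
        fun z => (z.1, φ i z.1 z.2) := by
  have hf := measurable_transfiniteRec hφ
  have hφi : Measurable fun z : (∀ j : Iio i, Y j) × Ω i => φ i z.1 z.2 := hφ i
  have joint : (Measure.infinitePi P).map
      (fun x => ((Iio i).domRestrict (transfiniteRec φ x), x i)) =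
      (((Measure.infinitePi P).map (transfiniteRec φ)).map (Iio i).domRestrict).prod (P i) := by
    rw [(indepFun_iff_map_prod_eq_prod_map_map (by fun_prop) (measurable_pi_apply i).aemeasurable).1
      (indepFun_domRestrict_Iio_transfiniteRec hφ P i), Measure.infinitePi_map_eval,
      Measure.map_map (by fun_prop) hf]
    rfl
  rw [← joint, Measure.map_map (by fun_prop) hf, Measure.map_map (by fun_prop) (by fun_prop)]
  congr 1
  ext1 x
  exact Prod.ext rfl (transfiniteRec_eq φ x i)

end TransfiniteRecursion

theorem map_prod_eq_compProd {α β Ω : Type*} [MeasurableSpace α] [MeasurableSpace β]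
    [MeasurableSpace Ω] (m : Measure α) [SFinite m] (ρ : Measure Ω) [SFinite ρ] (κ : Kernel α β)
    [IsSFiniteKernel κ] {φ : α → Ω → β} (hφ : Measurable φ.uncurry)
    (hκ : ∀ a, ρ.map (φ a) = κ a) :
    (m.prod ρ).map (fun z => (z.1, φ z.1 z.2)) = m ⊗ₘ κ := by
  have hg : Measurable fun z : α × Ω => (z.1, φ z.1 z.2) := measurable_fst.prodMk hφ
  ext s hs
  rw [Measure.map_apply hg hs, Measure.prod_apply (hg hs), Measure.compProd_apply hs]
  refine lintegral_congr fun a => ?_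
  rw [← hκ a, Measure.map_apply hφ.of_uncurry_left (measurable_prodMk_left hs)]
  rfl

theorem exists_measurePreserving_infinitePi {I : Type*} [LinearOrder I] [WellFoundedLT I]
    {Y : I → Type*} [∀ i, MeasurableSpace (Y i)] [∀ i, StandardBorelSpace (Y i)]
    (ν : Measure (∀ i, Y i)) [IsProbabilityMeasure ν] :
    ∃ f, MeasurePreserving f (Measure.infinitePi fun _ : I => (volume : Measure unitInterval))
      ν := by
  obtain ⟨y⟩ := nonempty_of_isProbabilityMeasure ν
  have (i : I) : Nonempty (Y i) := ⟨y i⟩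
  choose φ hφ hφ_map using fun i => Kernel.exists_measurable_map_eq_unitInterval
    (condDistrib (fun y : ∀ i, Y i => y i) (Iio i).domRestrict ν)
  have hf := measurable_transfiniteRec hφ
  set ν' := (Measure.infinitePi fun _ : I => (volume : Measure unitInterval)).map
    (transfiniteRec φ)
  have : IsProbabilityMeasure ν' := Measure.isProbabilityMeasure_map hf.aemeasurable
  refine ⟨transfiniteRec φ, hf, measure_pi_ext_of_map_domRestrict_Iic fun i => ?_⟩
  induction i using WellFoundedLT.induction with
  | ind i ih =>
    refine map_domRestrict_Iic_eq ?_
    calc ν'.map (fun y => ((Iio i).domRestrict y, y i))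
      _ = ((ν'.map (Iio i).domRestrict).prod volume).map fun z => (z.1, φ i z.1 z.2) :=
        map_transfiniteRec_eq_map_prod hφ _ i
      _ = ((ν.map (Iio i).domRestrict).prod volume).map fun z => (z.1, φ i z.1 z.2) := by
        rw [map_domRestrict_Iio_eq ih]
      _ = ν.map (Iio i).domRestrict ⊗ₘ condDistrib (fun y => y i) (Iio i).domRestrict ν :=
        map_prod_eq_compProd _ _ _ (hφ i) (hφ_map i)
      _ = ν.map fun y => ((Iio i).domRestrict y, y i) :=
        compProd_map_condDistrib (measurable_pi_apply i).aemeasurable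

theorem exists_measurePreserving_cantorMeasure {T I : Type*} (e : I × ℕ ↪ T) {Y : I → Type*}
    [∀ i, MeasurableSpace (Y i)] [∀ i, StandardBorelSpace (Y i)]
    (ν : Measure (∀ i, Y i)) [IsProbabilityMeasure ν] :
    ∃ f, MeasurePreserving f (cantorMeasure T) ν := by
  obtain ⟨_, _⟩ := exists_wellFoundedLT I
  obtain ⟨U, hU⟩ := exists_measurePreserving_cantorMeasure_infinitePi e
  obtain ⟨f, hf⟩ := exists_measurePreserving_infinitePi ν
  exact ⟨f ∘ U, hf.comp hU⟩

theorem lt_cov_iff {X : Type u} {I : Set (Set X)} {κ : Cardinal.{u}} :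
    (κ : WithTop Cardinal.{u}) < cov I ↔ ∀ A ⊆ I, ⋃₀ A = univ → κ < #A := by
  constructor
  · intro h A hA hA_cover
    exact WithTop.coe_lt_coe.1 (h.trans_le (iInf₂_le A ⟨hA, hA_cover⟩))
  · intro h
    refine (WithTop.coe_lt_coe.2 (Order.lt_succ κ)).trans_le (le_iInf₂ fun A hA => ?_)
    exact WithTop.coe_le_coe.2 (Order.succ_le_of_lt (h A hA.1 hA.2))

/-- No family of `μ`-null sets indexed by `T` covers `X`; for `T` of cardinality `κ` this says that
the covering number of the ideal of `μ`-null sets is greater than `κ`. It is stated in terms of the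
complements of the null sets: properties valid almost everywhere have a common witness. -/
def NoNullCover {X : Type*} [MeasurableSpace X] (T : Type*) (μ : Measure X) : Prop :=
  ∀ p : T → X → Prop, (∀ t, ∀ᵐ x ∂μ, p t x) → ∃ x, ∀ t, p t x

namespace NoNullCover

variable {X Z T J : Type*} [MeasurableSpace X] {μ : Measure X}

theorem of_quasiMeasurePreserving [MeasurableSpace Z] (h : NoNullCover T μ) {ν : Measure Z}
    {f : X → Z} (hf : Measure.QuasiMeasurePreserving f μ ν) : NoNullCover T ν := by
  intro p hp
  obtain ⟨x, hx⟩ := h (fun t x => p t (f x)) fun t => hf.ae (hp t)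
  exact ⟨f x, hx⟩

theorem of_embedding (h : NoNullCover T μ) (e : J ↪ T) : NoNullCover J μ := by
  intro p hp
  obtain ⟨x, hx⟩ := h (Function.extend e p fun _ _ => True) fun t => by
    by_cases ht : ∃ j, e j = t
    · obtain ⟨j, rfl⟩ := ht
      simpa only [e.injective.extend_apply] using hp j
    · simp [Function.extend_apply' _ _ _ ht]
  exact ⟨x, fun j => by simpa only [e.injective.extend_apply] using hx (e j)⟩

end NoNullCover

theorem lt_cov_nullIdeal_iff_noNullCover {X : Type u} [MeasurableSpace X] {μ : Measure X}
    {κ : Cardinal.{u}} {T : Type w} (hT : Cardinal.lift.{u} #T = Cardinal.lift.{w} κ) :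
    (κ : WithTop Cardinal.{u}) < cov (nullIdeal μ) ↔ NoNullCover T μ := by
  rw [lt_cov_iff]
  constructor
  · intro h p hp
    by_contra! cover
    have card_range : #(range fun t => {x | ¬ p t x}) ≤ κ := by
      rw [← Cardinal.lift_le.{w}, ← hT]
      exact Cardinal.mk_range_le_lift
    refine (h _ (range_subset_iff.2 hp) (eq_univ_of_forall fun x => ?_)).not_ge card_range
    exact (cover x).elim fun t ht => ⟨_, ⟨t, rfl⟩, ht⟩
  · intro h A hA hA_cover
    by_contra! hAκ
    obtain ⟨e⟩ : Nonempty (A ↪ T) := by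
      rwa [← Cardinal.lift_mk_le', hT, Cardinal.lift_le]
    obtain ⟨x, hx⟩ := h.of_embedding e (fun N x => x ∉ N.1) fun N =>
      measure_eq_zero_iff_ae_notMem.1 (hA N.2)
    obtain ⟨N, hN, hxN⟩ := hA_cover ▸ mem_univ x
    exact hx ⟨N, hN⟩ hxN

theorem exists_isCompact_isClosed_of_ae {K : Type*} [TopologicalSpace K] [R1Space K]
    [MeasurableSpace K] [BorelSpace K] {μ : Measure K} [IsFiniteMeasure μ]
    [μ.InnerRegularCompactLTTop] {p : K → Prop} (hp : ∀ᵐ k ∂μ, p k) :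
    ∃ F : ℕ → Set K, (∀ n, IsCompact (F n) ∧ IsClosed (F n)) ∧ (∀ n, ∀ k ∈ F n, p k) ∧
      ∀ᵐ k ∂μ, ∃ n, k ∈ F n := by
  obtain ⟨G, hG_ae, hG, hGp⟩ := hp.exists_measurable_mem
  choose F hFG hF_compact hF_closed hF_approx using fun n : ℕ =>
    hG.exists_isCompact_isClosed_sdiff_lt (measure_ne_top μ G) (ε := (n : ENNReal)⁻¹) (by simp)
  refine ⟨F, fun n => ⟨hF_compact n, hF_closed n⟩, fun n k hk => hGp k (hFG n hk), ?_⟩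
  have uncovered_null : μ (G \ ⋃ n, F n) = 0 :=
    le_bot_iff.1 <| ge_of_tendsto' ENNReal.tendsto_inv_nat_nhds_zero fun n =>
      (measure_mono (sdiff_subset_sdiff_right (subset_iUnion F n))).trans (hF_approx n).le
  filter_upwards [hG_ae, measure_eq_zero_iff_ae_notMem.1 uncovered_null] with k hkG hk
  by_contra! hkF
  exact hk ⟨hkG, by simpa using hkF⟩

theorem exists_forall_finset_measure_biInter_ne_zero {T : Type*} [Infinite T]
    (h : NoNullCover T (cantorMeasure T)) {X : Type*} [MeasurableSpace X] (μ : Measure X)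
    [IsProbabilityMeasure μ] {F : T → ℕ → Set X} (hF : ∀ t n, MeasurableSet (F t n))
    (hF_cover : ∀ t, ∀ᵐ x ∂μ, ∃ n, x ∈ F t n) :
    ∃ n : T → ℕ, ∀ s : Finset T, μ (⋂ t ∈ s, F t (n t)) ≠ 0 := by
  classical
  let pattern (x : X) (i : T × ℕ) : Prop := x ∈ F i.1 i.2
  have hpattern : Measurable pattern :=
    measurable_pi_lambda _ fun i => measurable_mem.2 (hF i.1 i.2)
  have := Measure.isProbabilityMeasure_map (μ := μ) hpattern.aemeasurable
  obtain ⟨e⟩ : Nonempty ((T × ℕ) × ℕ ↪ T) := (Cardinal.le_def _ _).1 (by simp)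
  obtain ⟨e'⟩ : Nonempty (Finset (T × ℕ) ⊕ T ↪ T) := (Cardinal.le_def _ _).1 (by simp)
  obtain ⟨f, hf⟩ := exists_measurePreserving_cantorMeasure e (μ.map pattern)
  have ae_nonnull (s : Finset (T × ℕ)) :
      ∀ᵐ A ∂μ.map pattern, (∀ i : s, A i) → μ (⋂ i ∈ s, F i.1 i.2) ≠ 0 := by
    refine (ae_map_iff hpattern.aemeasurable (measurableSet_setOfPred.2 (by fun_prop))).2 ?_
    rcases eq_or_ne (μ (⋂ i ∈ s, F i.1 i.2)) 0 with hs | hs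
    · filter_upwards [measure_eq_zero_iff_ae_notMem.1 hs] with x hx hxs
      exact (hx (mem_iInter₂.2 fun i hi => hxs ⟨i, hi⟩)).elim
    · exact .of_forall fun _ _ => hs
  have ae_exists (t : T) : ∀ᵐ A ∂μ.map pattern, ∃ n, A (t, n) :=
    (ae_map_iff hpattern.aemeasurable (measurableSet_setOfPred.2 (by fun_prop))).2 (hF_cover t)
  obtain ⟨A, hA⟩ := (h.of_quasiMeasurePreserving hf.quasiMeasurePreserving).of_embedding e'
    (Sum.elim _ _) (Sum.rec ae_nonnull ae_exists)
  obtain ⟨hA_nonnull, hA_exists⟩ := Sum.forall.1 hA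
  choose n hn using hA_exists
  refine ⟨n, fun s => ?_⟩
  rw [← Finset.set_biInter_finset_image (f := fun t => (t, n t)) (g := fun i => F i.1 i.2)]
  exact hA_nonnull _ fun ⟨i, hi⟩ => by grind

theorem NoNullCover.of_cantorMeasure {T : Type*} [Infinite T]
    (h : NoNullCover T (cantorMeasure T)) {K : Type*} [TopologicalSpace K] [R1Space K]
    [MeasurableSpace K] [BorelSpace K] (μ : Measure K) [IsProbabilityMeasure μ]
    [μ.InnerRegularCompactLTTop] : NoNullCover T μ := by
  intro p hp
  choose F hF hFp hF_cover using fun t => exists_isCompact_isClosed_of_ae (hp t)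
  obtain ⟨n, hn⟩ := exists_forall_finset_measure_biInter_ne_zero h μ
    (fun t n => (hF t n).2.measurableSet) hF_cover
  obtain ⟨t₀⟩ : Nonempty T := inferInstance
  have common_point : (F t₀ (n t₀) ∩ ⋂ t, F t (n t)).Nonempty := by
    classical
    refine (hF t₀ (n t₀)).1.inter_iInter_nonempty _ (fun t => (hF t (n t)).2) fun s => ?_
    rw [← Finset.set_biInter_insert t₀ s fun t => F t (n t)]
    exact nonempty_of_measure_ne_zero (hn _)
  obtain ⟨k, -, hk⟩ := common_point
  exact ⟨k, fun t => hFp t (n t) k (mem_iInter.1 hk t)⟩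

theorem corollary4p3_general {κ : Cardinal.{u}} (hκ : ℵ₀ ≤ κ)
    (h : (κ : WithTop Cardinal.{u}) < cov (nullIdealCantor κ)) {K : Type (max u v)}
    [TopologicalSpace K] [R1Space K] [MeasurableSpace K] [BorelSpace K] (μ : Measure K)
    [IsFiniteMeasureOnCompacts μ] [μ.InnerRegular] (hμ : μ ≠ 0) :
    ((Cardinal.lift.{v} κ : Cardinal) : WithTop Cardinal) < cov (nullIdeal μ) := by
  obtain ⟨C, hC, hμC⟩ := Measure.InnerRegular.exists_isCompact_not_null.2 hμ
  have : Infinite κ.out := Cardinal.infinite_iff.2 (by simpa using hκ)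
  have := cond_isProbabilityMeasure_of_finite hμC hC.measure_lt_top.ne
  have : (μ[|C]).InnerRegularCompactLTTop := by unfold ProbabilityTheory.cond; infer_instance
  rw [nullIdealCantor, lt_cov_nullIdeal_iff_noNullCover (T := κ.out) (by simp)] at h
  rw [lt_cov_nullIdeal_iff_noNullCover (T := κ.out) (by simp)]
  exact (NoNullCover.of_cantorMeasure h μ[|C]).of_quasiMeasurePreserving
    ⟨measurable_id, by simpa using cond_absolutelyContinuous⟩

theorem corollary4p3
    (h : ((ℵ₁ : Cardinal.{0}) : WithTop Cardinal.{0}) < cov (nullIdealCantor ℵ₁))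
    {K : Type*} [TopologicalSpace K] [CompactSpace K] [T2Space K]
    [MeasurableSpace K] [BorelSpace K]
    (μ : Measure K) [IsFiniteMeasure μ] [μ.InnerRegular] (hμ : μ ≠ 0) :
    ((ℵ₁ : Cardinal) : WithTop Cardinal) < cov (nullIdeal μ) := by
  simpa using corollary4p3_general (Cardinal.aleph0_le_aleph 1) h μ hμ
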